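/- Let $M$ be a smooth $3$-dimensional manifold (Hausdorff, without boundary) with a Riemannian metric $g$, Levi-Civita connection $\nabla$, curvature $R(X,Y)Z=\nabla_X\nabla_YZ-\nabla_Y\nabla_XZ-\nabla_{[X,Y]}Z$, Ricci tensor $S(Y,Z)=\operatorname{tr}\bigl(X\mapsto R(X,Y)Z\bigr)$ and scalar curvature $r=\operatorname{tr}_g S$. Let $(\phi,\xi,\eta)$ be an almost contact metric structure on $(M,g)$: a smooth $(1,1)$-tensor field $\phi$, a smooth vector field $\xi$ and a smooth $1$-form $\eta$ with $$\phi^2=-I+\eta\otimes\xi,\quad \eta(\xi)=1,\quad \eta(X)=g(X,\xi),\quad g(\phi X,\phi Y)=g(X,Y)-\eta(X)\eta(Y),\quad g(X,\phi Y)+g(Y,\phi X)=0 .$$ Suppose that it is trans-Sasakian of type $(\alpha,\beta)$ for smooth functions $\alpha,\beta:M\to\mathbb R$, that is, $$(\nabla_X\phi)Y=\alpha\,[g(X,Y)\xi-\eta(Y)X]+\beta\,[g(\phi X,Y)\xi-\eta(Y)\phi X]\qquad\text{for all vector fields } X,Y,$$ and that, for real constants $\lambda,\mu$, $(g,\xi,\lambda,\mu)$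 is an $\eta$-Einstein soliton: $$\mathcal L_\xi g+2S+(2\lambda-r)g+2\mu\,\eta\otimes\eta=0 .$$ Suppose that the Ricci tensor is of Codazzi type, i.e. $S$ is not identically zero and $(\nabla_XS)(Y,Z)=(\nabla_YS)(X,Z)$ for all vector fields $X,Y,Z$. Finally suppose $\alpha\neq0$, in the sense that $\alpha$ does not vanish identically on any connected component of $M$. Then $\beta=\mu$ at every point of $M$ (in particular $\beta$ is constant), $M$ is an Einstein manifold, i.e. $S=\kappa g$ for a constant $\kappa\in\mathbb R$, and its scalar curvature is constant, equal to $r=6\lambda+6\beta$. -/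

import Mathlib

open Bundle Manifold FiberBundle VectorField
open scoped ContDiff

noncomputable section

namespace EtaSoliton

variable {E : Type*} [NormedAddCommGroup E] [NormedSpace ℝ E]
  {H : Type*} [TopologicalSpace H] {I : ModelWithCorners ℝ E H}
  {M : Type*} [TopologicalSpace M] [ChartedSpace H M]
  [RiemannianBundle (fun x : M ↦ TangentSpace I x)]

/-- The right-hand side of the Koszul formula, i.e. the value which `2 g(∇_X Y, Z)` has to take
for the Levi-Civita connection `∇`. Here `d% f x v` is the derivative of `f` at `x` along `v`, and
`inner ℝ` on a tangent space is the Riemannian metric `g`. -/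
def koszul (X Y Z : Π x : M, TangentSpace I x) (x : M) : ℝ :=
  d% (fun y ↦ inner ℝ (Y y) (Z y)) x (X x) + d% (fun y ↦ inner ℝ (Z y) (X y)) x (Y x)
    - d% (fun y ↦ inner ℝ (X y) (Y y)) x (Z x)
    + inner ℝ (mlieBracket I X Y x) (Z x) - inner ℝ (mlieBracket I X Z x) (Y x)
    - inner ℝ (mlieBracket I Y Z x) (X x)

variable [IsManifold I ∞ M]
  [IsContMDiffRiemannianBundle I ∞ E
    (fun x : M ↦ TangentSpace I x)]
  {X Y Z : Π x : M, TangentSpace I x} {x : M}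

theorem mdiffAt_inner (hX : MDiffAt (T% X) x) (hY : MDiffAt (T% Y) x) :
    MDiffAt (fun y ↦ inner ℝ (X y) (Y y)) x :=
  MDifferentiableAt.inner_bundle (IB := I) (F := E) (E := fun x : M ↦ TangentSpace I x)
    (b := id) hX hY

variable [CompleteSpace E]

theorem koszul_tensorial_right (hX : MDiffAt (T% X) x) (hY : MDiffAt (T% Y) x) :
    TensorialAt I E (fun Z ↦ koszul X Y Z x) x where
  smul {f Z} hf hZ := by
    have h1 := mvfderiv_fun_mul hf (mdiffAt_inner hY hZ)
    have h2 := mvfderiv_fun_mul hf (mdiffAt_inner hZ hX)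
    simp only [koszul, Pi.smul_apply', inner_smul_left, inner_smul_right,
      mlieBracket_smul_right hf hZ, inner_add_left, h1, h2, RCLike.conj_to_real]
    simp [real_inner_comm]
    ring
  add {Z Z'} hZ hZ' := by
    have h1 := mvfderiv_fun_add (mdiffAt_inner hY hZ) (mdiffAt_inner hY hZ')
    have h2 := mvfderiv_fun_add (mdiffAt_inner hZ hX) (mdiffAt_inner hZ' hX)
    simp only [koszul, Pi.add_apply, inner_add_right, inner_add_left, h1, h2,
      mlieBracket_add_right hZ hZ']
    simp
    ring

theorem koszul_tensorial_left (hY : MDiffAt (T% Y) x) (hZ : MDiffAt (T% Z) x) :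
    TensorialAt I E (fun X ↦ koszul X Y Z x) x where
  smul {f X} hf hX := by
    have h1 := mvfderiv_fun_mul hf (mdiffAt_inner hX hY)
    have h2 := mvfderiv_fun_mul hf (mdiffAt_inner hZ hX)
    simp only [koszul, Pi.smul_apply', inner_smul_left, inner_smul_right,
      mlieBracket_smul_left hf hX, inner_add_left, h1, h2, RCLike.conj_to_real]
    simp [real_inner_comm]
    ring
  add {X X'} hX hX' := by
    have h1 := mvfderiv_fun_add (mdiffAt_inner hX hY) (mdiffAt_inner hX' hY)
    have h2 := mvfderiv_fun_add (mdiffAt_inner hZ hX) (mdiffAt_inner hZ hX')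
    simp only [koszul, Pi.add_apply, inner_add_right, inner_add_left, h1, h2,
      mlieBracket_add_left hX hX']
    simp
    ring

variable [FiniteDimensional ℝ E]

instance finiteDimensional_tangentSpace (x : M) : FiniteDimensional ℝ (TangentSpace I x) :=
  inferInstanceAs (FiniteDimensional ℝ E)

open scoped Classical in
/-- `leviCivitaFun Y x v` is `∇_v Y` at `x`: the tangent vector representing, through the metric,
half of the Koszul expression. It is given the value `0` where `Y` is not differentiable. -/
def leviCivitaFun (Y : Π x : M, TangentSpace I x) (x : M) :
    TangentSpace I x →L[ℝ] TangentSpace I x :=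
  haveI : CompleteSpace (TangentSpace I x) := FiniteDimensional.complete ℝ _
  if hY : MDiffAt (T% Y) x then
    (InnerProductSpace.toDual ℝ
        (TangentSpace I x)).symm.toContinuousLinearEquiv.toContinuousLinearMap ∘L
      ((1 / 2 : ℝ) • TensorialAt.mkHom₂ (fun X Z ↦ koszul X Y Z x) x
        (fun _ hZ ↦ koszul_tensorial_left hY hZ) (fun _ hX ↦ koszul_tensorial_right hX hY))
  else 0

theorem inner_leviCivitaFun (hX : MDiffAt (T% X) x) (hY : MDiffAt (T% Y) x)
    (hZ : MDiffAt (T% Z) x) :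
    inner ℝ (leviCivitaFun Y x (X x)) (Z x) = 1 / 2 * koszul X Y Z x := by
  have : CompleteSpace (TangentSpace I x) := FiniteDimensional.complete ℝ _
  have h := TensorialAt.mkHom₂_apply (Φ := fun X Z ↦ koszul X Y Z x)
    (fun _ hZ ↦ koszul_tensorial_left hY hZ) (fun _ hX ↦ koszul_tensorial_right hX hY) hX hZ
  rw [leviCivitaFun, dif_pos hY, ← h]
  exact InnerProductSpace.toDual_symm_apply

theorem ext_fields {A B : TangentSpace I x →L[ℝ] TangentSpace I x}
    (h : ∀ X Z : Π x : M, TangentSpace I x, MDiffAt (T% X) x → MDiffAt (T% Z) x →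
      inner ℝ (A (X x)) (Z x) = inner ℝ (B (X x)) (Z x)) : A = B := by
  ext v
  refine ext_inner_right ℝ fun w ↦ ?_
  simpa using h (extend E v) (extend E w) (mdifferentiableAt_extend ..)
    (mdifferentiableAt_extend ..)

/-- The Levi-Civita connection `∇` of the Riemannian metric; `leviCivita Y x (X x)` is
`(∇_X Y)(x)`. -/
def leviCivita : CovariantDerivative I E (fun x : M ↦ TangentSpace I x) where
  toFun := leviCivitaFun
  isCovariantDerivativeOnUniv := {
    add := fun {Y Y' x} hY hY' _ ↦ ext_fields fun X Z hX hZ ↦ by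
      have h1 := mvfderiv_fun_add (mdiffAt_inner hY hZ) (mdiffAt_inner hY' hZ)
      have h2 := mvfderiv_fun_add (mdiffAt_inner hX hY) (mdiffAt_inner hX hY')
      rw [inner_leviCivitaFun hX (mdifferentiableAt_add_section hY hY') hZ,
        add_apply, inner_add_left, inner_leviCivitaFun hX hY hZ,
        inner_leviCivitaFun hX hY' hZ]
      simp only [koszul, Pi.add_apply, inner_add_right, inner_add_left, h1, h2,
        mlieBracket_add_right hY hY', mlieBracket_add_left hY hY']
      simp
      ring
    leibniz := fun {Y f x} hY hf _ ↦ ext_fields fun X Z hX hZ ↦ by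
      have h1 := mvfderiv_fun_mul hf (mdiffAt_inner hY hZ)
      have h2 := mvfderiv_fun_mul hf (mdiffAt_inner hX hY)
      rw [inner_leviCivitaFun hX (hf.smul_section hY) hZ,
        add_apply, inner_add_left, smul_apply,
        inner_smul_left, inner_leviCivitaFun hX hY hZ]
      simp only [koszul, Pi.smul_apply', inner_smul_left, inner_smul_right, inner_add_left,
        mlieBracket_smul_right hf hY, mlieBracket_smul_left hf hY, h1, h2, RCLike.conj_to_real]
      simp [real_inner_comm, inner_smul_left]
      ring }

/-- The Levi-Civita connection is torsion free. -/
theorem leviCivita_torsion : (leviCivita (I := I) (M := M)).torsion = 0 := by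
  rw [CovariantDerivative.torsion_eq_zero_iff]
  intro X Y x hX hY
  refine ext_inner_right ℝ fun w ↦ ?_
  have hZ := mdifferentiableAt_extend I E w
  have h1 := inner_leviCivitaFun hX hY hZ
  have h2 := inner_leviCivitaFun hY hX hZ
  rw [extend_apply_self] at h1 h2
  rw [inner_sub_left]
  change inner ℝ (leviCivitaFun Y x (X x)) w - inner ℝ (leviCivitaFun X x (Y x)) w = _
  rw [h1, h2]
  simp only [koszul, mlieBracket_swap_apply (V := Y) (W := X), real_inner_comm, inner_neg_right]
  simp 
  ring

/-- The Levi-Civita connection is compatible with the metric. -/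
theorem leviCivita_metric (hX : MDiffAt (T% X) x) (hY : MDiffAt (T% Y) x)
    (hZ : MDiffAt (T% Z) x) :
    d% (fun y ↦ inner ℝ (Y y) (Z y)) x (X x) =
      inner ℝ (leviCivita Y x (X x)) (Z x) + inner ℝ (Y x) (leviCivita Z x (X x)) := by
  have h1 := inner_leviCivitaFun hX hY hZ
  have h2 := inner_leviCivitaFun hX hZ hY
  change _ = inner ℝ (leviCivitaFun Y x (X x)) (Z x) + inner ℝ (Y x) (leviCivitaFun Z x (X x))
  rw [real_inner_comm (leviCivitaFun Z x (X x)), h1, h2]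
  simp only [koszul, mlieBracket_swap_apply (V := Z) (W := Y), real_inner_comm, inner_neg_right]
  simp
  ring

/-- `(∇_X Y)(x)` for the Levi-Civita connection. -/
def nabla (X Y : Π x : M, TangentSpace I x) (x : M) : TangentSpace I x := leviCivita Y x (X x)

/-- The curvature `R(X, Y)Z = ∇_X ∇_Y Z - ∇_Y ∇_X Z - ∇_{[X, Y]} Z`. -/
def curvature (X Y Z : Π x : M, TangentSpace I x) (x : M) : TangentSpace I x :=
  nabla X (nabla Y Z) x - nabla Y (nabla X Z) x - nabla (mlieBracket I X Y) Z x

/-- The Ricci tensor `S(v, w) = ∑ i, g(R(e i, v) w, e i)` at `x`, with `e` an orthonormal basis of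
the tangent space at `x`. The tangent vectors are extended to vector fields that are smooth near
`x`; by tensoriality of the curvature the choice of the extensions is immaterial. -/
def ricci (x : M) (v w : TangentSpace I x) : ℝ :=
  ∑ i, inner ℝ
    (curvature (extend E (stdOrthonormalBasis ℝ (TangentSpace I x) i)) (extend E v) (extend E w) x)
    (stdOrthonormalBasis ℝ (TangentSpace I x) i)

variable (I) in
/-- The scalar curvature `r`, the metric trace of the Ricci tensor. -/
def scalarCurvature (x : M) : ℝ :=
  ∑ i, ricci (I := I) x (stdOrthonormalBasis ℝ (TangentSpace I x) i)
    (stdOrthonormalBasis ℝ (TangentSpace I x) i)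

/-- The covariant derivative of the Ricci tensor,
`(∇_X S)(Y, Z) = X (S(Y, Z)) - S(∇_X Y, Z) - S(Y, ∇_X Z)`. -/
def nablaRicci (X Y Z : Π x : M, TangentSpace I x) (x : M) : ℝ :=
  d% (fun y ↦ ricci y (Y y) (Z y)) x (X x) - ricci x (nabla X Y x) (Z x)
    - ricci x (Y x) (nabla X Z x)

/-- The Lie derivative of the metric,
`(L_V g)(X, Y) = V (g(X, Y)) - g([V, X], Y) - g(X, [V, Y])`. -/
def lieDerivMetric (V X Y : Π x : M, TangentSpace I x) (x : M) : ℝ :=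
  d% (fun y ↦ inner ℝ (X y) (Y y)) x (V x) - inner ℝ (mlieBracket I V X x) (Y x)
    - inner ℝ (X x) (mlieBracket I V Y x)

variable (I M) in
/-- The Ricci tensor is of Codazzi type: it is not identically zero and
`(∇_X S)(Y, Z) = (∇_Y S)(X, Z)` for all smooth vector fields. -/
def IsCodazziRicci : Prop :=
  (∃ (x : M) (v w : TangentSpace I x), ricci x v w ≠ 0) ∧
    ∀ X Y Z : Π x : M, TangentSpace I x, CMDiff ∞ (T% X) → CMDiff ∞ (T% Y) → CMDiff ∞ (T% Z) →
      ∀ x, nablaRicci X Y Z x = nablaRicci Y X Z x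

variable (I M) in
/-- `M` is an Einstein manifold: `S = κ g` for a constant `κ`. -/
def IsEinstein : Prop :=
  ∃ κ : ℝ, ∀ (x : M) (v w : TangentSpace I x), ricci x v w = κ * inner ℝ v w

variable (I M) in
/-- An almost contact metric structure `(φ, ξ, η)` on the Riemannian manifold `M`. -/
structure AlmostContactMetricStructure where
  /-- The `(1,1)` tensor field `φ`. -/
  φ : Π x : M, TangentSpace I x →L[ℝ] TangentSpace I x
  /-- The characteristic vector field `ξ`. -/
  ξ : Π x : M, TangentSpace I x
  /-- The `1`-form `η`. -/
  η : Π x : M, TangentSpace I x →L[ℝ] ℝ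
  contMDiff_φ : ContMDiff I (I.prod 𝓘(ℝ, E →L[ℝ] E)) ∞
    (fun x ↦ TotalSpace.mk' (E →L[ℝ] E)
      (E := fun x : M ↦ TangentSpace I x →L[ℝ] TangentSpace I x) x (φ x))
  contMDiff_ξ : CMDiff ∞ (T% ξ)
  contMDiff_η : ContMDiff I (I.prod 𝓘(ℝ, E →L[ℝ] ℝ)) ∞
    (fun x ↦ TotalSpace.mk' (E →L[ℝ] ℝ) (E := fun x : M ↦ TangentSpace I x →L[ℝ] ℝ) x (η x))
  φ_sq : ∀ (x : M) (v : TangentSpace I x), φ x (φ x v) = -v + η x v • ξ x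
  η_ξ : ∀ x : M, η x (ξ x) = 1
  η_eq : ∀ (x : M) (v : TangentSpace I x), η x v = inner ℝ v (ξ x)
  inner_φ_φ : ∀ (x : M) (v w : TangentSpace I x),
    inner ℝ (φ x v) (φ x w) = inner ℝ v w - η x v * η x w
  inner_φ_add : ∀ (x : M) (v w : TangentSpace I x),
    inner ℝ v (φ x w) + inner ℝ w (φ x v) = 0

namespace AlmostContactMetricStructure

/-- The structure is trans-Sasakian of type `(α, β)`, where `α` and `β` are smooth functions:
`(∇_X φ) Y = α (g(X, Y) ξ - η(Y) X) + β (g(φ X, Y) ξ - η(Y) φ X)` for all smooth vector fields,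
where `(∇_X φ) Y = ∇_X (φ Y) - φ (∇_X Y)`. -/
def IsTransSasakian (A : AlmostContactMetricStructure I M) (α β : M → ℝ) : Prop :=
  CMDiff ∞ α ∧ CMDiff ∞ β ∧
    ∀ X Y : Π x : M, TangentSpace I x, CMDiff ∞ (T% X) → CMDiff ∞ (T% Y) → ∀ x,
      nabla X (fun y ↦ A.φ y (Y y)) x - A.φ x (nabla X Y x) =
        α x • ((inner ℝ (X x) (Y x) : ℝ) • A.ξ x - A.η x (Y x) • X x)
          + β x • ((inner ℝ (A.φ x (X x)) (Y x) : ℝ) • A.ξ x - A.η x (Y x) • A.φ x (X x))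

/-- `(g, ξ, lam, mu)` is an `η`-Einstein soliton:
`L_ξ g + 2 S + (2 lam - r) g + 2 mu η ⊗ η = 0`. -/
def IsEtaEinsteinSoliton (A : AlmostContactMetricStructure I M) (lam mu : ℝ) : Prop :=
  ∀ X Y : Π x : M, TangentSpace I x, CMDiff ∞ (T% X) → CMDiff ∞ (T% Y) → ∀ x,
    lieDerivMetric A.ξ X Y x + 2 * ricci x (X x) (Y x)
      + (2 * lam - scalarCurvature I x) * inner ℝ (X x) (Y x)
      + 2 * mu * (A.η x (X x) * A.η x (Y x)) = 0

end AlmostContactMetricStructure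

end EtaSoliton

end

open Bundle Manifold FiberBundle VectorField
open scoped ContDiff Topology

noncomputable section

namespace EtaSoliton

/-! ### Global extension of tangent vectors, and a Grönwall argument in charts -/

section

variable {E : Type*} [NormedAddCommGroup E] [NormedSpace ℝ E]
  {H : Type*} [TopologicalSpace H] {I : ModelWithCorners ℝ E H}
  {M : Type*} [TopologicalSpace M] [ChartedSpace H M] [IsManifold I ∞ M]

/-! The trans-Sasakian identity at `Y = ξ` gives `∇_X ξ = -α φX + β (X - η(X) ξ)`, so `L_ξ g = 2β (g
- η ⊗ η)`. The soliton equation and its trace in dimension 3 then yield `r = 6λ + 4β + 2μ` and `S =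
(2λ + β + μ) g + (β - μ) η ⊗ η`.

For this `S`, the Codazzi equation is a pointwise condition on `dβ`, `α` and `β`. Testing it on `ξ`,
`v` and `φv` with `v ⊥ ξ` gives `(β - μ) α = 0` and `dβ = (β - μ) β η` (`sub_mul_eq_zero`,
`mvfderiv_eq`).

The first equation alone is not enough, since `α` may vanish on an open set. The second is a linear
differential equation for `β - μ`, so by Grönwall the zero set of `β - μ` is open as well as closed
(`isClopen_eq`). One point with `α ≠ 0` in each component then forces `β = μ` everywhere. -/

/-- On a Hausdorff manifold every tangent vector extends to a smooth global vector field. -/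
theorem exists_contMDiff_vectorField [FiniteDimensional ℝ E] [T2Space M] (x : M)
    (v : TangentSpace I x) :
    ∃ X : Π y : M, TangentSpace I y, CMDiff ∞ (T% X) ∧ X x = v := by
  obtain ⟨s, hs, hv⟩ := exists_contMDiffOn_extend (k := ∞) I E
    (V := fun x : M ↦ TangentSpace I x) v
  obtain ⟨u, hus, hu, hxu⟩ := mem_nhds_iff.1 hs
  -- A bump function with closed support inside `u` cuts the local extension off to a global field.
  obtain ⟨f, -, hf⟩ :=
    (SmoothBumpFunction.nhds_basis_tsupport (I := I) x).mem_iff.1 (hu.mem_nhds hxu)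
  exact ⟨_, ContMDiffOn.smul_section_of_tsupport f.contMDiff.contMDiffOn hu hf (hv.mono hus),
    by simp⟩

/-- A differentiable function whose differential is bounded by a multiple of the function
vanishes near each of its zeros. -/
theorem isOpen_zeros_of_norm_mvfderiv_le [I.Boundaryless]
    [RiemannianBundle (fun x : M ↦ TangentSpace I x)]
    [IsContinuousRiemannianBundle E (fun x : M ↦ TangentSpace I x)]
    {h c : M → ℝ} (hh : ∀ x, MDiffAt h x) (hc : Continuous c)
    (hd : ∀ (x : M) (v : TangentSpace I x), |d% h x v| ≤ c x * ‖v‖ * |h x|) :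
    IsOpen {x | h x = 0} := by
  rw [isOpen_iff_mem_nhds]
  intro x hx
  set ψ := (extChartAt I x).symm
  set p := extChartAt I x x
  -- Near `x`, `C` bounds the Riemannian norm by the coordinate norm.
  obtain ⟨C, C_pos, hC⟩ := eventually_norm_symmL_trivializationAt_lt E
    (fun x : M ↦ TangentSpace I x) x
  have hcont : ContinuousAt ψ p := continuousAt_extChartAt_symm x
  have hψp : ψ p = x := extChartAt_to_inv x
  have h1 : ∀ᶠ y in 𝓝 x, c y < c x + 1 := hc.continuousAt.eventually_lt_const (by linarith)
  have h2 : ∀ᶠ z in 𝓝 p, z ∈ (extChartAt I x).target ∧ c (ψ z) < c x + 1 ∧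
      ‖(trivializationAt E (fun x : M ↦ TangentSpace I x) x).symmL ℝ (ψ z)‖ < C := by
    refine Filter.Eventually.and (extChartAt_target_mem_nhds x) ?_
    refine hcont.eventually (p := fun y ↦ c y < c x + 1 ∧
      ‖(trivializationAt E (fun x : M ↦ TangentSpace I x) x).symmL ℝ y‖ < C) ?_
    rw [hψp]
    exact h1.and hC
  obtain ⟨r, hr, hball⟩ := Metric.eventually_nhds_iff_ball.1 h2
  have key : ∀ z ∈ Metric.ball p r, h (ψ z) = 0 := by
    intro z hz
    -- Along the chart segment from `p` to `z`, the hypothesis becomes an inequality `|f'| ≤ K |f|`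
    -- with `f 0 = 0`.
    set γ : ℝ → E := fun t ↦ p + t • (z - p)
    have hγ : ∀ t ∈ Set.Icc (0 : ℝ) 1, γ t ∈ Metric.ball p r := by
      intro t ht
      simpa [γ] using (convex_ball p r).add_smul_sub_mem (Metric.mem_ball_self hr) hz ht
    have hder : ∀ t ∈ Set.Icc (0 : ℝ) 1, ∃ d : ℝ, HasDerivAt (fun t ↦ h (ψ (γ t))) d t ∧
        |d| ≤ ((|c x| + 1) * C * ‖z - p‖) * |h (ψ (γ t))| := by
      intro t ht
      obtain ⟨hzt, hcz, hCz⟩ := hball _ (hγ t ht)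
      have hψd : MDifferentiableAt 𝓘(ℝ, E) I ψ (γ t) := by
        have := mdifferentiableOn_extChartAt_symm (I := I) (x := x) _ hzt
        exact this.mdifferentiableAt ((isOpen_extChartAt_target x).mem_nhds hzt)
      have hcomp : HasFDerivAt (h ∘ ψ) ((d% h (ψ (γ t))).comp (mfderiv 𝓘(ℝ, E) I ψ (γ t))) (γ t) :=
        ((hh _).hasMFDerivAt.comp (γ t) hψd.hasMFDerivAt).hasFDerivAt
      have hγd : HasDerivAt γ (z - p) t := by
        simpa only [one_smul, id] using ((hasDerivAt_id t).smul_const (z - p)).const_add p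
      refine ⟨_, hcomp.comp_hasDerivAt t hγd, ?_⟩
      -- The differential of the inverse chart is the inverse trivialization, so `C` bounds it.
      have hsymm : mfderiv 𝓘(ℝ, E) I ψ (γ t) =
          (trivializationAt E (fun x : M ↦ TangentSpace I x) x).symmL ℝ (ψ (γ t)) := by
        have hsrc : ψ (γ t) ∈ (extChartAt I x).source := (extChartAt I x).map_target hzt
        rw [extChartAt_source] at hsrc
        rw [TangentBundle.symmL_trivializationAt hsrc, (extChartAt I x).right_inv hzt,
          I.range_eq_univ, mfderivWithin_univ]
      change |d% h (ψ (γ t)) (mfderiv 𝓘(ℝ, E) I ψ (γ t) (z - p))| ≤ _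
      rw [hsymm]
      refine (hd _ _).trans ?_
      have hle := ((trivializationAt E (fun x : M ↦ TangentSpace I x) x).symmL ℝ
        (ψ (γ t))).le_of_opNorm_le hCz.le (z - p)
      have hcz' : c (ψ (γ t)) ≤ |c x| + 1 := hcz.le.trans (by gcongr; exact le_abs_self _)
      refine mul_le_mul_of_nonneg_right ?_ (abs_nonneg _)
      calc _ ≤ (|c x| + 1) * _ := mul_le_mul_of_nonneg_right hcz' (norm_nonneg _)
        _ ≤ (|c x| + 1) * (C * ‖z - p‖) := mul_le_mul_of_nonneg_left hle (by positivity)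
        _ = _ := by ring
    choose! d hd1 hd2 using hder
    have := eq_zero_of_abs_deriv_le_mul_abs_self_of_eq_zero_right (a := 0) (b := 1)
      (f := fun t ↦ h (ψ (γ t))) (f' := d)
      (fun t ht ↦ (hd1 t ht).continuousAt.continuousWithinAt)
      (fun t ht ↦ (hd1 t ⟨ht.1, ht.2.le⟩).hasDerivWithinAt) (by simpa [γ, hψp] using hx)
      (fun t ht ↦ hd2 t ⟨ht.1, ht.2.le⟩) 1 (by simp)
    simpa [γ] using this
  have h3 : ∀ᶠ y in 𝓝 x, extChartAt I x y ∈ Metric.ball p r :=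
    (continuousAt_extChartAt x).eventually (Metric.ball_mem_nhds p hr)
  filter_upwards [h3, extChartAt_source_mem_nhds (I := I) x] with y hy hys
  have := key _ hy
  rwa [(extChartAt I x).left_inv hys] at this

end

variable {E : Type*} [NormedAddCommGroup E] [NormedSpace ℝ E]
  {H : Type*} [TopologicalSpace H] {I : ModelWithCorners ℝ E H}
  {M : Type*} [TopologicalSpace M] [ChartedSpace H M]
  [RiemannianBundle (fun x : M ↦ TangentSpace I x)] [IsManifold I ∞ M]

/-! ### Pointwise algebra of the structure -/

namespace AlmostContactMetricStructure

variable (A : AlmostContactMetricStructure I M)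

theorem φ_ξ (x : M) : A.φ x (A.ξ x) = 0 := by
  have h := A.inner_φ_φ x (A.ξ x) (A.ξ x)
  have h2 := A.η_eq x (A.ξ x)
  rw [A.η_ξ] at h h2
  exact inner_self_eq_zero (𝕜 := ℝ).1 (by linarith)

theorem inner_φ_ξ (x : M) (v : TangentSpace I x) : inner ℝ (A.φ x v) (A.ξ x) = 0 := by
  have h := A.inner_φ_add x v (A.ξ x)
  rw [φ_ξ, inner_zero_right, real_inner_comm] at h
  linarith

theorem mdiffAt_ξ (x : M) : MDiffAt (T% A.ξ) x :=
  (A.contMDiff_ξ x).mdifferentiableAt (by simp)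

theorem inner_ξ_ξ (x : M) : inner ℝ (A.ξ x) (A.ξ x) = 1 := by
  rw [← A.η_eq, A.η_ξ]

theorem η_φ (x : M) (v : TangentSpace I x) :
    A.η x (A.φ x v) = 0 := by
  rw [A.η_eq, A.inner_φ_ξ]

theorem inner_φ_self (x : M) (v : TangentSpace I x) :
    inner ℝ v (A.φ x v) = 0 := by
  have := A.inner_φ_add x v v
  linarith

theorem exists_ne_zero_η_eq_zero (A : AlmostContactMetricStructure I M)
    (hE : 1 < Module.finrank ℝ E) (x : M) : ∃ v : TangentSpace I x, v ≠ 0 ∧ A.η x v = 0 := by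
  have : FiniteDimensional ℝ E := .of_finrank_pos (by omega)
  have : FiniteDimensional ℝ (TangentSpace I x) := inferInstanceAs (FiniteDimensional ℝ E)
  have hd : Module.finrank ℝ ℝ < Module.finrank ℝ (TangentSpace I x) := by
    rw [Module.finrank_self]
    exact hE
  obtain ⟨v, hv, hv0⟩ := (Submodule.ne_bot_iff _).1
    ((A.η x : TangentSpace I x →ₗ[ℝ] ℝ).ker_ne_bot_of_finrank_lt hd)
  exact ⟨v, hv0, hv⟩

/-- Parseval for the unit vector `ξ`; the sum is the trace of `η ⊗ η`. -/
theorem sum_η_sq (x : M) [FiniteDimensional ℝ (TangentSpace I x)] :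
    ∑ i, A.η x (stdOrthonormalBasis ℝ (TangentSpace I x) i) *
      A.η x (stdOrthonormalBasis ℝ (TangentSpace I x) i) = 1 := by
  simp only [A.η_eq]
  rw [← A.inner_ξ_ξ x, ← (stdOrthonormalBasis ℝ (TangentSpace I x)).sum_inner_mul_inner]
  exact Finset.sum_congr rfl fun i _ ↦ by rw [real_inner_comm (A.ξ x)]

end AlmostContactMetricStructure

variable [IsContMDiffRiemannianBundle I ∞ E (fun x : M ↦ TangentSpace I x)]
  [CompleteSpace E] [FiniteDimensional ℝ E]

/-! ### The covariant derivative of `ξ` and the Lie derivative of the metric -/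

theorem lieDerivMetric_eq {V X Y : Π x : M, TangentSpace I x} {x : M} (hV : MDiffAt (T% V) x)
    (hX : MDiffAt (T% X) x) (hY : MDiffAt (T% Y) x) :
    lieDerivMetric V X Y x = inner ℝ (nabla X V x) (Y x) + inner ℝ (X x) (nabla Y V x) := by
  have h := @(CovariantDerivative.torsion_eq_zero_iff _).1 (leviCivita_torsion (I := I) (M := M))
  rw [lieDerivMetric, leviCivita_metric hV hX hY, ← h hV hX, ← h hV hY]
  simp only [nabla, inner_sub_left, inner_sub_right]
  ring

namespace AlmostContactMetricStructure

variable {A : AlmostContactMetricStructure I M} {α β : M → ℝ}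

theorem IsTransSasakian.leviCivita_ξ [T2Space M] (hA : A.IsTransSasakian α β) (x : M)
    (v : TangentSpace I x) :
    leviCivita A.ξ x v = -α x • A.φ x v + β x • (v - A.η x v • A.ξ x) := by
  obtain ⟨X, hX, rfl⟩ := exists_contMDiff_vectorField x v
  have hX' : MDiffAt (T% X) x := (hX x).mdifferentiableAt (by simp)
  have h := hA.2.2 X A.ξ hX A.contMDiff_ξ x
  have h0 : nabla X (fun y ↦ A.φ y (A.ξ y)) x = 0 := by
    have : (fun y ↦ A.φ y (A.ξ y)) = 0 := funext A.φ_ξ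
    rw [this, nabla, CovariantDerivative.zero]
    rfl
  have hm := leviCivita_metric hX' (A.mdiffAt_ξ x) (A.mdiffAt_ξ x)
  -- Differentiating `g(ξ, ξ) = 1` shows `∇_X ξ ⊥ ξ`.
  have hη : A.η x (leviCivita A.ξ x (X x)) = 0 := by
    simp only [A.inner_ξ_ξ, mvfderiv_const, real_inner_comm, zero_apply] at hm
    rw [A.η_eq, real_inner_comm]
    linarith
  -- Since `φξ = 0`, `h` determines `φ(∇_X ξ)`; on `ξ^⊥` a second `φ` inverts the first up to sign.
  have h1 := congrArg (A.φ x) h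
  rw [h0, nabla] at h1
  simp only [map_sub, map_zero, map_add, map_smul, A.φ_sq, A.φ_ξ, hη, A.inner_φ_ξ, A.η_ξ] at h1
  calc leviCivita A.ξ x (X x)
      = 0 - (-leviCivita A.ξ x (X x) + (0 : ℝ) • A.ξ x) := by module
    _ = _ := by rw [h1]; module

/-- The `α` terms cancel because `φ` is skew. -/
theorem IsTransSasakian.lieDerivMetric_ξ [T2Space M] (hA : A.IsTransSasakian α β)
    {X Y : Π x : M, TangentSpace I x} {x : M} (hX : MDiffAt (T% X) x) (hY : MDiffAt (T% Y) x) :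
    lieDerivMetric A.ξ X Y x =
      2 * β x * (inner ℝ (X x) (Y x) - A.η x (X x) * A.η x (Y x)) := by
  have h1 := A.inner_φ_add x (X x) (Y x)
  rw [lieDerivMetric_eq (A.mdiffAt_ξ x) hX hY, nabla, nabla, hA.leviCivita_ξ, hA.leviCivita_ξ]
  simp only [inner_add_left, inner_add_right, inner_smul_left, inner_smul_right, inner_sub_left,
    inner_sub_right, RCLike.conj_to_real, ← A.η_eq]
  rw [real_inner_comm (Y x) (A.φ x (X x)), real_inner_comm (Y x) (A.ξ x), ← A.η_eq]
  linear_combination (-α x) * h1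

/-! ### The Ricci tensor of the soliton and its covariant derivative -/

variable {lam mu : ℝ}

theorem IsEtaEinsteinSoliton.ricci_eq_of_scalarCurvature [T2Space M]
    (hsol : A.IsEtaEinsteinSoliton lam mu) (hA : A.IsTransSasakian α β) (x : M)
    (v w : TangentSpace I x) :
    ricci x v w = (scalarCurvature I x / 2 - lam - β x) * inner ℝ v w
      + (β x - mu) * (A.η x v * A.η x w) := by
  obtain ⟨X, hX, rfl⟩ := exists_contMDiff_vectorField x v
  obtain ⟨Y, hY, rfl⟩ := exists_contMDiff_vectorField x w
  have h := hsol X Y hX hY x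
  rw [hA.lieDerivMetric_ξ ((hX x).mdifferentiableAt (by simp))
    ((hY x).mdifferentiableAt (by simp))] at h
  linear_combination h / 2

theorem IsEtaEinsteinSoliton.scalarCurvature_eq [T2Space M]
    (hsol : A.IsEtaEinsteinSoliton lam mu) (hA : A.IsTransSasakian α β)
    (hE : Module.finrank ℝ E = 3) (x : M) :
    scalarCurvature I x = 6 * lam + 4 * β x + 2 * mu := by
  have hd : Module.finrank ℝ (TangentSpace I x) = 3 := hE
  have h : scalarCurvature I x = 3 * (scalarCurvature I x / 2 - lam - β x) + (β x - mu) := by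
    conv_lhs => rw [scalarCurvature]
    simp only [hsol.ricci_eq_of_scalarCurvature hA, Finset.sum_add_distrib, ← Finset.mul_sum,
      A.sum_η_sq, real_inner_self_eq_norm_sq, OrthonormalBasis.norm_eq_one]
    simp [hd]
    ring
  linarith

theorem IsEtaEinsteinSoliton.ricci_eq [T2Space M]
    (hsol : A.IsEtaEinsteinSoliton lam mu) (hA : A.IsTransSasakian α β)
    (hE : Module.finrank ℝ E = 3) (x : M) (v w : TangentSpace I x) :
    ricci x v w = (2 * lam + β x + mu) * inner ℝ v w + (β x - mu) * (A.η x v * A.η x w) := by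
  rw [hsol.ricci_eq_of_scalarCurvature hA, hsol.scalarCurvature_eq hA hE]
  ring

/-- Both coefficients of `S` have differential `dβ`. As `∇g = 0`, the rest comes from `(∇_X η)(Y) =
g(Y, ∇_X ξ)`. -/
theorem IsEtaEinsteinSoliton.nablaRicci_eq [T2Space M]
    (hsol : A.IsEtaEinsteinSoliton lam mu) (hA : A.IsTransSasakian α β)
    (hE : Module.finrank ℝ E = 3) {X Y Z : Π x : M, TangentSpace I x} {x : M}
    (hX : MDiffAt (T% X) x) (hY : MDiffAt (T% Y) x) (hZ : MDiffAt (T% Z) x) :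
    nablaRicci X Y Z x = d% β x (X x) * (inner ℝ (Y x) (Z x) + A.η x (Y x) * A.η x (Z x))
      + (β x - mu) * (inner ℝ (Y x) (leviCivita A.ξ x (X x)) * A.η x (Z x)
        + A.η x (Y x) * inner ℝ (Z x) (leviCivita A.ξ x (X x))) := by
  have hβ : MDiffAt β x := (hA.2.1 x).mdifferentiableAt (by simp)
  have hc (c : ℝ) : MDiffAt (fun _ : M ↦ c) x := mdifferentiableAt_const
  have hξ := A.mdiffAt_ξ x
  have hf : MDiffAt (fun y ↦ 2 * lam + mu + β y) x := (hc _).add hβ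
  have hg : MDiffAt (fun y ↦ -mu + β y) x := (hc _).add hβ
  have hη {V : Π x : M, TangentSpace I x} (hV : MDiffAt (T% V) x) := mdiffAt_inner hV hξ
  have e : (fun y ↦ ricci y (Y y) (Z y)) = fun y ↦ (2 * lam + mu + β y) * inner ℝ (Y y) (Z y)
      + (-mu + β y) * (inner ℝ (Y y) (A.ξ y) * inner ℝ (Z y) (A.ξ y)) := by
    funext y
    rw [hsol.ricci_eq hA hE, A.η_eq, A.η_eq]
    ring
  have hηη : MDiffAt (fun y ↦ inner ℝ (Y y) (A.ξ y) * inner ℝ (Z y) (A.ξ y)) x :=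
    (hη hY).mul (hη hZ)
  have h1 : MDiffAt (fun y ↦ (2 * lam + mu + β y) * inner ℝ (Y y) (Z y)) x :=
    hf.mul (mdiffAt_inner hY hZ)
  have h2 : MDiffAt
      (fun y ↦ (-mu + β y) * (inner ℝ (Y y) (A.ξ y) * inner ℝ (Z y) (A.ξ y))) x := hg.mul hηη
  rw [nablaRicci, e, mvfderiv_fun_add h1 h2,
    mvfderiv_fun_mul hf (mdiffAt_inner hY hZ), mvfderiv_fun_mul hg hηη,
    mvfderiv_fun_mul (hη hY) (hη hZ), mvfderiv_fun_add (hc _) hβ, mvfderiv_fun_add (hc _) hβ,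
    mvfderiv_const, mvfderiv_const, hsol.ricci_eq hA hE, hsol.ricci_eq hA hE]
  simp only [add_apply, smul_apply, zero_apply, smul_eq_mul, leviCivita_metric hX hY hZ,
    leviCivita_metric hX hY hξ, leviCivita_metric hX hZ hξ, nabla, A.η_eq]
  ring

/-- For a Codazzi Ricci tensor, `∇ S` is symmetric in the first two tangent vectors. -/
theorem IsEtaEinsteinSoliton.codazzi [T2Space M]
    (hsol : A.IsEtaEinsteinSoliton lam mu) (hA : A.IsTransSasakian α β)
    (hE : Module.finrank ℝ E = 3) (hcod : IsCodazziRicci I M) (x : M)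
    (u v w : TangentSpace I x) :
    d% β x u * (inner ℝ v w + A.η x v * A.η x w)
      + (β x - mu) * (inner ℝ v (leviCivita A.ξ x u) * A.η x w
        + A.η x v * inner ℝ w (leviCivita A.ξ x u)) =
    d% β x v * (inner ℝ u w + A.η x u * A.η x w)
      + (β x - mu) * (inner ℝ u (leviCivita A.ξ x v) * A.η x w
        + A.η x u * inner ℝ w (leviCivita A.ξ x v)) := by
  obtain ⟨X, hX, rfl⟩ := exists_contMDiff_vectorField x u
  obtain ⟨Y, hY, rfl⟩ := exists_contMDiff_vectorField x v
  obtain ⟨Z, hZ, rfl⟩ := exists_contMDiff_vectorField x w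
  have h := hcod.2 X Y Z hX hY hZ x
  have hX' : MDiffAt (T% X) x := (hX x).mdifferentiableAt (by simp)
  have hY' : MDiffAt (T% Y) x := (hY x).mdifferentiableAt (by simp)
  have hZ' : MDiffAt (T% Z) x := (hZ x).mdifferentiableAt (by simp)
  rwa [hsol.nablaRicci_eq hA hE hX' hY' hZ', hsol.nablaRicci_eq hA hE hY' hX' hZ'] at h

/-! ### Consequences of the Codazzi equation, and globalisation -/

section pointwise

variable [T2Space M] (hsol : A.IsEtaEinsteinSoliton lam mu) (hA : A.IsTransSasakian α β)
  (hE : Module.finrank ℝ E = 3) (hcod : IsCodazziRicci I M)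
include hsol hA hE hcod

/-- On `(v, φv, ξ)` with `v ⊥ ξ` the `dβ` terms drop out, and the skew part of `∇ξ` contributes `∓(β
- μ) α |v|²` to the two sides. -/
theorem IsEtaEinsteinSoliton.sub_mul_eq_zero (x : M) : (β x - mu) * α x = 0 := by
  obtain ⟨v, hv0, hv⟩ := A.exists_ne_zero_η_eq_zero (by omega) x
  have h := hsol.codazzi hA hE hcod x v (A.φ x v) (A.ξ x)
  have h2 := A.inner_φ_φ x v v
  have h3 := real_inner_comm v (A.φ x v)
  simp only [hA.leviCivita_ξ, inner_add_right, inner_sub_right, inner_smul_right, ← A.η_eq, A.η_φ,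
    hv, A.φ_sq, A.η_ξ, inner_neg_right] at h h2
  have : (β x - mu) * α x * inner ℝ v v = 0 := by
    linear_combination (-1 / 2) * h - (β x - mu) * α x / 2 * h2 + (β x - mu) * β x / 2 * h3
  exact (mul_eq_zero.1 this).resolve_right (inner_self_ne_zero.2 hv0)

/-- On `(v, φv, φv)` only `dβ(v) |φv|²` survives, and `|φv| = |v|`. -/
theorem IsEtaEinsteinSoliton.mvfderiv_eq_zero {x : M} {v : TangentSpace I x}
    (hv : A.η x v = 0) : d% β x v = 0 := by
  rcases eq_or_ne v 0 with rfl | hv0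
  · simp
  have h := hsol.codazzi hA hE hcod x v (A.φ x v) (A.φ x v)
  simp only [A.inner_φ_φ, A.η_φ, hv, A.inner_φ_self] at h
  have : d% β x v * inner ℝ v v = 0 := by linear_combination h
  exact (mul_eq_zero.1 this).resolve_right (inner_self_ne_zero.2 hv0)

/-- On `(ξ, v, v)` with `v ⊥ ξ` the right side reduces to `(β - μ) g(v, ∇_v ξ) = (β - μ) β |v|²`. -/
theorem IsEtaEinsteinSoliton.mvfderiv_ξ (x : M) :
    d% β x (A.ξ x) = (β x - mu) * β x := by
  obtain ⟨v, hv0, hv⟩ := A.exists_ne_zero_η_eq_zero (by omega) x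
  have h := hsol.codazzi hA hE hcod x (A.ξ x) v v
  simp only [hA.leviCivita_ξ, inner_add_right, inner_sub_right, inner_smul_right, ← A.η_eq,
    A.inner_φ_self, hv, A.η_ξ] at h
  have : (d% β x (A.ξ x) - (β x - mu) * β x) * inner ℝ v v = 0 := by
    linear_combination h + hsol.mvfderiv_eq_zero hA hE hcod hv * inner ℝ (A.ξ x) v
  exact sub_eq_zero.1 ((mul_eq_zero.1 this).resolve_right (inner_self_ne_zero.2 hv0))

theorem IsEtaEinsteinSoliton.mvfderiv_eq (x : M) (v : TangentSpace I x) :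
    d% β x v = (β x - mu) * β x * A.η x v := by
  have h := hsol.mvfderiv_eq_zero hA hE hcod (v := v - A.η x v • A.ξ x) (by simp [A.η_ξ])
  rw [map_sub, map_smul, hsol.mvfderiv_ξ hA hE hcod, smul_eq_mul] at h
  linear_combination h

theorem IsEtaEinsteinSoliton.isClopen_eq [I.Boundaryless] : IsClopen {x | β x - mu = 0} := by
  have hβ (x : M) : MDiffAt β x := (hA.2.1 x).mdifferentiableAt (by simp)
  have hcβ : Continuous β := hA.2.1.continuous
  have hc (x : M) : MDiffAt (fun _ : M ↦ mu) x := mdifferentiableAt_const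
  have : IsContinuousRiemannianBundle E (fun x : M ↦ TangentSpace I x) := by
    obtain ⟨g, hg, h⟩ := IsContMDiffRiemannianBundle.exists_contMDiff (IB := I) (n := ∞) (F := E)
      (E := fun x : M ↦ TangentSpace I x)
    exact ⟨g, hg.continuous, h⟩
  refine ⟨isClosed_eq (by fun_prop) continuous_const,
    isOpen_zeros_of_norm_mvfderiv_le (I := I) (c := fun x ↦ |β x|)
      (fun x ↦ (hβ x).sub (hc x)) (by fun_prop) fun x v ↦ ?_⟩
  -- Cauchy–Schwarz with `|ξ| = 1`; hence the Grönwall coefficient `|β|`.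
  have hη : |A.η x v| ≤ ‖v‖ := by
    have hξ : ‖A.ξ x‖ = 1 := by
      rw [norm_eq_sqrt_real_inner, A.inner_ξ_ξ, Real.sqrt_one]
    simpa [A.η_eq, hξ] using abs_real_inner_le_norm v (A.ξ x)
  have hd : d% (fun x ↦ β x - mu) x v = (β x - mu) * β x * A.η x v := by
    rw [mvfderiv_fun_sub (hβ x) (hc x), mvfderiv_const, sub_zero, hsol.mvfderiv_eq hA hE hcod]
  rw [hd, abs_mul, abs_mul]
  calc |β x - mu| * |β x| * |A.η x v| ≤ |β x - mu| * |β x| * ‖v‖ := by gcongr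
    _ = _ := by ring

theorem IsEtaEinsteinSoliton.eq_of_forall_exists_ne_zero [I.Boundaryless]
    (hα : ∀ x : M, ∃ y ∈ connectedComponent x, α y ≠ 0) (x : M) : β x = mu := by
  obtain ⟨y, hy, hy0⟩ := hα x
  have h0 : y ∈ {x | β x - mu = 0} :=
    (mul_eq_zero.1 (hsol.sub_mul_eq_zero hA hE hcod y)).resolve_right hy0
  refine sub_eq_zero.1 ((hsol.isClopen_eq hA hE hcod).connectedComponent_subset h0 ?_)
  rw [← connectedComponent_eq hy]
  exact mem_connectedComponent

end pointwise

end AlmostContactMetricStructure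

end EtaSoliton

end

theorem theorem4p3 {M : Type*} [TopologicalSpace M] [T2Space M]
    [ChartedSpace (EuclideanSpace ℝ (Fin 3)) M] [IsManifold (𝓡 3) ∞ M]
    [RiemannianBundle (fun x : M ↦ TangentSpace (𝓡 3) x)]
    [IsContMDiffRiemannianBundle (𝓡 3) ∞ (EuclideanSpace ℝ (Fin 3))
      (fun x : M ↦ TangentSpace (𝓡 3) x)]
    (A : EtaSoliton.AlmostContactMetricStructure (𝓡 3) M) (α β : M → ℝ)
    (hA : A.IsTransSasakian α β)
    (lam mu : ℝ) (hsol : A.IsEtaEinsteinSoliton lam mu)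
    (hcod : EtaSoliton.IsCodazziRicci (𝓡 3) M)
    (hα : ∀ x : M, ∃ y ∈ connectedComponent x, α y ≠ 0) :
    (∀ x : M, β x = mu) ∧
      EtaSoliton.IsEinstein (𝓡 3) M ∧
      (∃ c : ℝ, ∀ x : M, EtaSoliton.scalarCurvature (𝓡 3) x = c) ∧
      ∀ x : M, EtaSoliton.scalarCurvature (𝓡 3) x = 6 * lam + 6 * β x := by
  have hE : Module.finrank ℝ (EuclideanSpace ℝ (Fin 3)) = 3 := by simp
  have hβ := hsol.eq_of_forall_exists_ne_zero hA hE hcod hα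
  have hr := hsol.scalarCurvature_eq hA hE
  refine ⟨hβ, ⟨2 * lam + 2 * mu, fun x v w ↦ ?_⟩, ⟨6 * lam + 6 * mu, fun x ↦ ?_⟩, fun x ↦ ?_⟩
  · rw [hsol.ricci_eq hA hE, hβ]
    ring
  · rw [hr, hβ]
    ring
  · rw [hr, hβ]
    ring
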